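/- Let $\mathcal{A}$ be a locally noetherian Grothendieck category, i.e. a Grothendieck abelian category that has a (small) set of noetherian objects which generates it; an object is noetherian if its subobjects satisfy the ascending chain condition. Assume that $\mathcal{A}$ has finite global dimension, i.e. there is an integer $n \ge 0$ such that $\mathrm{Ext}^i_{\mathcal{A}}(X,Y)=0$ for all objects $X, Y$ of $\mathcal{A}$ and all $i \ge n$. Let $\mathcal{U} \subset \mathcal{A}$ be the full subcategory of noetherian objects, which is an abelian category with exact inclusion functor. Let $\mathrm{D}(\mathcal{U})$ and $\mathrm{D}(\mathcal{A})$ be the unbounded derived categories and let $\mathrm{D}_{\mathcal{U}}(\mathcal{A}) \subset \mathrm{D}(\mathcal{A})$ be the full triangulated subcategory of those objects $C$ with $\mathrm{H}^i(C) \in \mathcal{U}$ for all $i \in \mathbb{Z}$. Then the functor $$\mathrm{D}(\mathcal{U}) \longrightarrow \mathrm{D}_{\mathcal{U}}(\mathcal{A})$$ induced by the inclusion $\mathcal{U} \subset \mathcal{A}$ is a triangulated functor and an equivalence of categories. -/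

import Mathlib

open CategoryTheory CategoryTheory.Limits

universe w w₁ w₂ v u

namespace LocallyNoetherianDerived

section Conditions

variable (C : Type u) [Category.{v} C] [Abelian C]

/-- An abelian category has finite global dimension if there is a uniform bound `n` such that
`Ext^i(X, Y) = 0` for all objects `X`, `Y` and all `i ≥ n`. (The case `n = 0` is the zero
category, of global dimension `-1`.) -/
def HasFiniteGlobalDimension : Prop :=
  ∃ n : ℕ, ∀ X : C, HasProjectiveDimensionLT X n

/-- A locally noetherian Grothendieck category: a Grothendieck abelian category that has a
small generating family consisting of noetherian objects. -/
class IsLocallyNoetherian : Prop extends IsGrothendieckAbelian.{w} C where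
  exists_noetherian_generators : ∃ P : ObjectProperty C,
    ObjectProperty.Small.{w} P ∧ P ≤ isNoetherianObject ∧ P.IsSeparating

end Conditions

section Noetherian

variable {C : Type u} [Category.{v} C] [Abelian C]

lemma isNoetherianObject_of_epi {X Y : C} (f : X ⟶ Y) [Epi f]
    (hX : isNoetherianObject X) : isNoetherianObject Y := by
  have hX' : WellFoundedGT (Subobject X) := hX
  have hmono : Monotone (fun S : Subobject Y => (Subobject.pullback f).obj S) :=
    (Subobject.pullback f).monotone
  have hle : ∀ S T : Subobject Y,
      (Subobject.pullback f).obj T ≤ (Subobject.pullback f).obj S → T ≤ S := by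
    intro S T h
    obtain ⟨A', π, hπ, x, hx⟩ := surjective_up_to_refinements_of_epi f T.arrow
    have h1 : ((Subobject.pullback f).obj S).Factors x := by
      refine Subobject.factors_of_le x h ?_
      rw [Limits.pullback_factors_iff, ← hx]
      exact Subobject.factors_comp_arrow π
    rw [Limits.pullback_factors_iff, ← hx] at h1
    have h2 : π ≫ T.arrow ≫ cokernel.π S.arrow = 0 := by
      rw [← Category.assoc, ← Subobject.factorThru_arrow S _ h1, Category.assoc,
        cokernel.condition, comp_zero]
    have h3 : T.arrow ≫ cokernel.π S.arrow = 0 := by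
      rw [← cancel_epi π, h2, comp_zero]
    exact Subobject.le_of_comm (Abelian.monoLift S.arrow T.arrow h3)
      (Abelian.monoLift_comp S.arrow T.arrow h3)
  have hstrict : StrictMono (fun S : Subobject Y => (Subobject.pullback f).obj S) :=
    hmono.strictMono_of_injective fun S T h =>
      le_antisymm (hle T S h.le) (hle S T h.ge)
  exact hstrict.wellFoundedGT

lemma isNoetherianObject_of_shortExact {E : ShortComplex C} (hE : E.ShortExact)
    (h₁ : isNoetherianObject E.X₁) (h₃ : isNoetherianObject E.X₃) :
    isNoetherianObject E.X₂ := by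
  have h₁' : WellFoundedGT (Subobject E.X₁) := h₁
  have h₃' : WellFoundedGT (Subobject E.X₃) := h₃
  let F : Subobject E.X₂ → Subobject E.X₁ × Subobject E.X₃ := fun S =>
    ((Subobject.pullback E.f).obj S, imageSubobject (S.arrow ≫ E.g))
  have hmono : Monotone F := by
    intro S T h
    refine ⟨(Subobject.pullback E.f).monotone h, ?_⟩
    change imageSubobject (S.arrow ≫ E.g) ≤ imageSubobject (T.arrow ≫ E.g)
    rw [← Subobject.ofLE_arrow h, Category.assoc]
    exact imageSubobject_comp_le _ _
  have hle : ∀ S T : Subobject E.X₂, S ≤ T → F S = F T → T ≤ S := by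
    intro S T hST hF
    have hp : (Subobject.pullback E.f).obj S = (Subobject.pullback E.f).obj T :=
      congrArg Prod.fst hF
    have hi : imageSubobject (S.arrow ≫ E.g) = imageSubobject (T.arrow ≫ E.g) :=
      congrArg Prod.snd hF
    have hfac : (imageSubobject (S.arrow ≫ E.g)).Factors (T.arrow ≫ E.g) := by
      rw [hi]
      simpa using imageSubobject_factors_comp_self (T.arrow ≫ E.g) (𝟙 _)
    obtain ⟨A, π, hπ, s, hs⟩ := surjective_up_to_refinements_of_epi
      (factorThruImageSubobject (S.arrow ≫ E.g))
      (Subobject.factorThru _ (T.arrow ≫ E.g) hfac)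
    have hs' : π ≫ T.arrow ≫ E.g = s ≫ S.arrow ≫ E.g := by
      have := congrArg (fun k => k ≫ (imageSubobject (S.arrow ≫ E.g)).arrow) hs
      simpa using this
    have hz : (π ≫ T.arrow - s ≫ S.arrow) ≫ E.g = 0 := by
      rw [Preadditive.sub_comp, Category.assoc, Category.assoc, hs', sub_self]
    obtain ⟨A', π', hπ', x, hx⟩ := hE.exact.exact_up_to_refinements _ hz
    have hxT : ((Subobject.pullback E.f).obj S).Factors x := by
      rw [hp, Limits.pullback_factors_iff, ← hx]
      have : π' ≫ (π ≫ T.arrow - s ≫ S.arrow) =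
          (π' ≫ (π - s ≫ Subobject.ofLE S T hST)) ≫ T.arrow := by
        simp
      rw [this]
      exact Subobject.factors_comp_arrow _
    rw [Limits.pullback_factors_iff, ← hx] at hxT
    have h2 : (π' ≫ (π ≫ T.arrow - s ≫ S.arrow)) ≫ cokernel.π S.arrow = 0 := by
      rw [← Subobject.factorThru_arrow S _ hxT, Category.assoc, cokernel.condition, comp_zero]
    have h3 : T.arrow ≫ cokernel.π S.arrow = 0 := by
      rw [← cancel_epi π, ← cancel_epi π']
      simpa using h2
    exact Subobject.le_of_comm (Abelian.monoLift S.arrow T.arrow h3)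
      (Abelian.monoLift_comp S.arrow T.arrow h3)
  have hstrict : StrictMono F := fun S T h =>
    lt_of_le_of_ne (hmono h.le) fun hF => h.not_ge (hle S T h.le hF)
  exact hstrict.wellFoundedGT

instance : (isNoetherianObject (C := C)).IsClosedUnderQuotients where
  prop_of_epi f _ hX := isNoetherianObject_of_epi f hX

instance : (isNoetherianObject (C := C)).IsClosedUnderExtensions where
  prop_X₂_of_shortExact hS h₁ h₃ := isNoetherianObject_of_shortExact hS h₁ h₃

instance : (isNoetherianObject (C := C)).IsSerreClass where

end Noetherian

section SerreSubcategory

variable {C : Type u} [Category.{v} C] [Abelian C] (P : ObjectProperty C) [P.IsSerreClass]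

instance : P.IsClosedUnderBinaryProducts where
  limitsOfShape_le := by
    rintro X ⟨p⟩
    have h := P.prop_X₂_of_shortExact
      (ShortComplex.Splitting.ofHasBinaryBiproduct
        (p.diag.obj (.mk .left)) (p.diag.obj (.mk .right))).shortExact
      (p.prop_diag_obj _) (p.prop_diag_obj _)
    refine P.prop_of_iso ?_ h
    exact (biprod.isoProd _ _) ≪≫ IsLimit.conePointUniqueUpToIso (prodIsProd _ _)
      ((IsLimit.postcomposeHomEquiv (diagramIsoPair p.diag) _).2 p.isLimit)

instance : P.IsClosedUnderFiniteProducts := .mk'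

instance : PreservesFiniteLimits P.ι := by
  have := P.preservesKernels_ι
  have : ∀ {X Y : P.FullSubcategory} (f : X ⟶ Y), PreservesLimit (parallelPair f 0) P.ι :=
    fun f => P.preservesKernels_ι f
  exact Functor.preservesFiniteLimits_of_preservesKernels P.ι

instance : PreservesFiniteColimits P.ι := by
  have : ∀ {X Y : P.FullSubcategory} (f : X ⟶ Y), PreservesColimit (parallelPair f 0) P.ι :=
    fun f => P.preservesCokernels_ι f
  exact Functor.preservesFiniteColimits_of_preservesCokernels P.ι

variable [HasDerivedCategory.{w} C]

/-- The objects of the derived category of `C` all of whose cohomology objects belong to `P`.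
The corresponding full subcategory is `D_P(C)`. -/
def cohomologyIn : ObjectProperty (DerivedCategory C) := fun K =>
  ∀ n : ℤ, P ((DerivedCategory.homologyFunctor C n).obj K)

instance : (cohomologyIn P).IsClosedUnderIsomorphisms where
  of_iso e h n := P.prop_of_iso ((DerivedCategory.homologyFunctor C n).mapIso e) (h n)

instance : (cohomologyIn P).IsTriangulated where
  exists_zero := ⟨_, isZero_zero (DerivedCategory C), fun n =>
    P.prop_of_isZero ((DerivedCategory.homologyFunctor C n).map_isZero (isZero_zero _))⟩
  isStableUnderShiftBy a :=
    { le_shift := fun K hK n => P.prop_of_iso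
        (((DerivedCategory.homologyFunctor C 0).shiftIso a n (a + n) rfl).symm.app K)
        (hK (a + n)) }
  toIsTriangulatedClosed₂ := .mk' fun T hT h₁ h₃ n =>
    P.prop_X₂_of_exact ((DerivedCategory.homologyFunctor C n).map_distinguished_exact T hT)
      (h₁ n) (h₃ n)

variable [HasDerivedCategory.{w₁} P.FullSubcategory]

lemma cohomologyIn_mapDerivedCategory_obj (K : DerivedCategory P.FullSubcategory) :
    cohomologyIn P (P.ι.mapDerivedCategory.obj K) := by
  intro n
  let L := DerivedCategory.Q.objPreimage K
  let e : P.ι.mapDerivedCategory.obj K ≅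
      DerivedCategory.Q.obj ((P.ι.mapHomologicalComplex (ComplexShape.up ℤ)).obj L) :=
    P.ι.mapDerivedCategory.mapIso (DerivedCategory.Q.objObjPreimageIso K).symm ≪≫
      P.ι.mapDerivedCategoryFactors.app L
  let e' : (DerivedCategory.homologyFunctor C n).obj (P.ι.mapDerivedCategory.obj K) ≅
      P.ι.obj (L.sc n).homology :=
    (DerivedCategory.homologyFunctor C n).mapIso e ≪≫
      (DerivedCategory.homologyFunctorFactors C n).app _ ≪≫
      (L.sc n).mapHomologyIso P.ι
  exact P.prop_of_iso e'.symm (L.sc n).homology.property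

/-- The functor `D(P) ⥤ D_P(C)` induced by the exact inclusion `P ⥤ C` of a Serre subcategory:
it sends a complex of objects of `P` to the same complex, regarded as a complex in `C`. -/
noncomputable def derivedComparison :
    DerivedCategory P.FullSubcategory ⥤ (cohomologyIn P).FullSubcategory :=
  (cohomologyIn P).lift P.ι.mapDerivedCategory (cohomologyIn_mapDerivedCategory_obj P)

noncomputable instance : (derivedComparison P).CommShift ℤ :=
  inferInstanceAs (((cohomologyIn P).lift P.ι.mapDerivedCategory
    (cohomologyIn_mapDerivedCategory_obj P)).CommShift ℤ)

end SerreSubcategory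

end LocallyNoetherianDerived

/-! Write `P` for the Serre subcategory of noetherian objects. By calculus of fractions
(`HasResolutions.isEquivalence_derivedComparison`) it suffices that every complex with cohomology in
`P` receives a quasi-isomorphism from a complex with terms in `P`.

The input from noetherianity is `HasLiftsAlongEpis`: an epimorphism onto a noetherian object is
already epimorphic on some noetherian object mapping to its source. By descending induction on the
degree this resolves everything up to a given degree by a subcomplex (`exists_subcomplex`).

An unbounded complex is resolved by a tower of such approximations in degrees `≤ k`, for `k = 0, 1,
2, ...`. The colimit has terms in `P` provided each degree changes only finitely often. Finite
global dimension ensures this: the complex glued on in passing from `k` to `k + 1` can be chosen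
bounded, in degrees from `k - n` to `k + 1` (`exists_bounded_approximation`,
`exists_next_approximation`). -/

namespace LocallyNoetherianDerived

/-! ### Noetherian lifts along epimorphisms -/

section LiftsAlongEpis

variable {C : Type u} [Category.{v} C] [Abelian C]

lemma subobject_factors_iff {X Y : C} (S : Subobject Y) (f : X ⟶ Y) :
    S.Factors f ↔ f ≫ cokernel.π S.arrow = 0 := by
  constructor
  · intro h
    rw [← S.factorThru_arrow f h, Category.assoc, cokernel.condition, comp_zero]
  · intro h
    rw [← Abelian.monoLift_comp S.arrow f h]
    exact Subobject.factors_comp_arrow _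

lemma subobject_factors_of_epi {X' X Y : C} (S : Subobject Y) (p : X' ⟶ X) [Epi p] (f : X ⟶ Y)
    (h : S.Factors (p ≫ f)) : S.Factors f := by
  rw [subobject_factors_iff, Category.assoc] at h
  rw [subobject_factors_iff, ← cancel_epi p, h, comp_zero]

/-- Epimorphisms onto objects of `P` are still epimorphic on some object of `P` mapping to
their source. -/
def HasLiftsAlongEpis (P : ObjectProperty C) : Prop :=
  ∀ ⦃X Y : C⦄ (p : X ⟶ Y) [Epi p], P Y → ∃ (X₀ : C) (g : X₀ ⟶ X), P X₀ ∧ Epi (g ≫ p)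

/-- Choose `X₀` so that its image in `Y` is maximal among images of noetherian objects over `X`. If
it were not all of `Y`, some generator `G ⟶ X` would have image outside it, and `X₀ ⊞ G` would have
a larger image. -/
lemma hasLiftsAlongEpis_isNoetherianObject {P : ObjectProperty C}
    (hP : P ≤ isNoetherianObject) (hP' : P.IsSeparating) :
    HasLiftsAlongEpis (isNoetherianObject (C := C)) := by
  intro X Y p _ hY
  have : WellFoundedGT (Subobject Y) := hY
  let s : Set (Subobject Y) := { S | ∃ (X₀ : C) (g : X₀ ⟶ X), isNoetherianObject X₀ ∧
    imageSubobject (g ≫ p) = S }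
  have hs : s.Nonempty :=
    ⟨_, Y, 0, hY, rfl⟩
  obtain ⟨_, ⟨X₀, g, hX₀, rfl⟩, hmax⟩ := wellFounded_gt.has_min s hs
  refine ⟨X₀, g, hX₀, ?_⟩
  refine Preadditive.epi_of_cokernel_zero ?_
  rw [← cancel_epi p, comp_zero]
  refine hP' _ _ fun G hG h => ?_
  rw [comp_zero]
  by_contra hne
  refine hmax (imageSubobject (biprod.desc g h ≫ p))
    ⟨X₀ ⊞ G, _, isNoetherianObject.prop_biprod hX₀ (hP _ hG), rfl⟩ (lt_of_le_of_ne ?_ ?_)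
  · have := imageSubobject_comp_le (biprod.inl : X₀ ⟶ X₀ ⊞ G) (biprod.desc g h ≫ p)
    simpa using this
  · intro heq
    apply hne
    have h1 : (imageSubobject (g ≫ p)).Factors (h ≫ p) := by
      rw [heq]
      have := imageSubobject_factors_comp_self (biprod.desc g h ≫ p) (biprod.inr : G ⟶ X₀ ⊞ G)
      simpa using this
    rw [← Category.assoc, ← Subobject.factorThru_arrow _ _ h1, Category.assoc]
    have : (imageSubobject (g ≫ p)).arrow ≫ cokernel.π (g ≫ p) = 0 := by
      rw [← cancel_epi (factorThruImageSubobject (g ≫ p)), imageSubobject_arrow_comp_assoc,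
        cokernel.condition, comp_zero]
    rw [this, comp_zero]

end LiftsAlongEpis

/-! ### Subcomplexes in a Serre subcategory, by descending induction -/

section Subcomplex

variable {C : Type u} [Category.{v} C] [Abelian C]

/-- The subcomplex given by a family of subobjects which is stable under the differentials. -/
noncomputable def subcomplex {ι : Type*} {c : ComplexShape ι} (K : HomologicalComplex C c)
    (S : ∀ i, Subobject (K.X i)) (hS : ∀ i j, (S j).Factors ((S i).arrow ≫ K.d i j)) :
    HomologicalComplex C c where
  X i := S i
  d i j := (S j).factorThru _ (hS i j)
  shape i j hij := by
    rw [← cancel_mono (S j).arrow]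
    simp [K.shape i j hij]
  d_comp_d' i j k _ _ := by
    rw [← cancel_mono (S k).arrow]
    simp

/-- The inclusion of the subcomplex given by a family of subobjects. -/
noncomputable def subcomplexι {ι : Type*} {c : ComplexShape ι} (K : HomologicalComplex C c)
    (S : ∀ i, Subobject (K.X i)) (hS : ∀ i j, (S j).Factors ((S i).arrow ≫ K.d i j)) :
    subcomplex K S hS ⟶ K where
  f i := (S i).arrow
  comm' i j _ := ((S j).factorThru_arrow _ (hS i j)).symm

instance {ι : Type*} {c : ComplexShape ι} (K : HomologicalComplex C c)
    (S : ∀ i, Subobject (K.X i)) (hS : ∀ i j, (S j).Factors ((S i).arrow ≫ K.d i j)) (i : ι) :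
    Mono ((subcomplexι K S hS).f i) :=
  inferInstanceAs (Mono (S i).arrow)

lemma factors_iff_subcomplexι {ι : Type*} {c : ComplexShape ι} (K : HomologicalComplex C c)
    (S : ∀ i, Subobject (K.X i)) (hS : ∀ i j, (S j).Factors ((S i).arrow ≫ K.d i j)) (i : ι)
    {B : C} (x : B ⟶ K.X i) :
    (S i).Factors x ↔ ∃ y, y ≫ (subcomplexι K S hS).f i = x :=
  ⟨fun h => ⟨(S i).factorThru x h, (S i).factorThru_arrow x h⟩, fun ⟨y, hy⟩ => by
    rw [← hy]
    exact Subobject.factors_comp_arrow (P := S i) y⟩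

/-- A subobject `S` in degree `i` of a cochain complex is adapted to a subobject `T` in degree
`i + 1` if it is mapped to `T`, if every boundary in `T` comes locally from `S`, and
if every cocycle in degree `i` is locally cohomologous to a cocycle in `S`. -/
structure IsAdapted (K : CochainComplex C ℤ) {i j : ℤ} (S : Subobject (K.X i))
    (T : Subobject (K.X j)) : Prop where
  factors : T.Factors (S.arrow ≫ K.d i j)
  boundary : ∀ ⦃B : C⦄ (y : B ⟶ K.X i), T.Factors (y ≫ K.d i j) →
    ∃ (B' : C) (π : B' ⟶ B) (_ : Epi π) (x : B' ⟶ K.X i), S.Factors x ∧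
      π ≫ y ≫ K.d i j = x ≫ K.d i j
  cocycle : ∀ ⦃B : C⦄ (y : B ⟶ K.X i), y ≫ K.d i j = 0 →
    ∃ (B' : C) (π : B' ⟶ B) (_ : Epi π) (x : B' ⟶ K.X i) (z : B' ⟶ K.X (i - 1)),
      S.Factors x ∧ x ≫ K.d i j = 0 ∧ π ≫ y = x + z ≫ K.d (i - 1) i

variable {P : ObjectProperty C} [P.IsSerreClass]

lemma exists_isAdapted (hP : HasLiftsAlongEpis P) (K : CochainComplex C ℤ) (i j : ℤ)
    (hij : i + 1 = j) (hi : P (K.homology i)) (T : Subobject (K.X j)) (hT : P (T : C)) :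
    ∃ S : Subobject (K.X i), P (S : C) ∧ IsAdapted K S T := by
  -- The image of the pullback in `T` is the part of `T` consisting of boundaries; it lies in `P` as
  -- a subobject of `T`. `X` covers these boundaries, `W` covers the cohomology in degree `i`, and
  -- `S` is the image of `X ⊞ W`.
  obtain ⟨X, g, hX, hg⟩ := hP (factorThruImage (pullback.snd (K.d i j) T.arrow))
    (P.prop_of_mono (image.ι _) hT)
  obtain ⟨W, w, hW, hw⟩ := hP (K.homologyπ i) hi
  let φ : X ⊞ W ⟶ K.X i := biprod.desc (g ≫ pullback.fst _ _) (w ≫ K.iCycles i)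
  have hφ : ∀ ⦃B : C⦄ (b : B ⟶ X ⊞ W), (imageSubobject φ).Factors (b ≫ φ) :=
    fun B b => imageSubobject_factors_comp_self φ b
  have hprev : (ComplexShape.up ℤ).prev i = i - 1 := by simp
  refine ⟨imageSubobject φ, P.prop_of_epi (factorThruImageSubobject φ) (P.prop_biprod hX hW),
    ?_, ?_, ?_⟩
  · refine subobject_factors_of_epi _ (factorThruImageSubobject φ) _ ?_
    rw [imageSubobject_arrow_comp_assoc]
    have : φ ≫ K.d i j = biprod.desc (g ≫ pullback.snd _ _) 0 ≫ T.arrow := by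
      ext <;> simp [φ, pullback.condition]
    rw [this]
    exact Subobject.factors_comp_arrow _
  · intro B y hy
    obtain ⟨B', π, hπ, x, hx⟩ := surjective_up_to_refinements_of_epi
      (g ≫ factorThruImage (pullback.snd (K.d i j) T.arrow))
      (pullback.lift y (T.factorThru _ hy) (by simp) ≫ factorThruImage _)
    refine ⟨B', π, hπ, (x ≫ biprod.inl) ≫ φ, hφ _, ?_⟩
    have := congrArg (fun k => k ≫ image.ι _ ≫ T.arrow) hx
    simp only [Category.assoc, image.fac_assoc, ← pullback.condition,
      pullback.lift_fst_assoc] at this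
    simpa [φ, ← pullback.condition] using this
  · intro B y hy
    have hnext : (ComplexShape.up ℤ).next i = j := by simp [hij]
    obtain ⟨B', π, hπ, x, hx⟩ := surjective_up_to_refinements_of_epi
      (w ≫ K.homologyπ i) (K.liftCycles y j hnext hy ≫ K.homologyπ i)
    simp only [← Category.assoc] at hx
    obtain ⟨B'', π', hπ', z, hz⟩ := (K.comp_homologyπ_eq_iff_up_to_refinements (i - 1) i hprev
      _ _).1 hx
    refine ⟨B'', π' ≫ π, epi_comp _ _, (π' ≫ x ≫ biprod.inr) ≫ φ, z, hφ _, by simp [φ], ?_⟩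
    have := congrArg (fun k => k ≫ K.iCycles i) hz
    simpa [φ] using this

lemma exists_subcomplex (hP : HasLiftsAlongEpis P) (K : CochainComplex C ℤ) (m : ℤ)
    (hK : ∀ i ≤ m, P (K.homology i)) :
    ∃ (S : CochainComplex C ℤ) (f : S ⟶ K), (∀ i, P (S.X i)) ∧ (∀ i, m < i → IsZero (S.X i)) ∧
      ∀ i ≤ m, QuasiIsoAt f i := by
  have hbot : ∀ i, P ((⊥ : Subobject (K.X i)) : C) := fun i =>
    P.prop_of_isZero ((isZero_zero C).of_iso Subobject.botCoeIsoZero)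
  choose G hG hG' using exists_isAdapted (P := P) hP K
  -- Zero in degrees `≥ m + 1`; below, each term is adapted to the one after it.
  let S : ∀ i, { S : Subobject (K.X i) // P (S : C) } := fun i =>
    Int.inductionOn' (motive := fun i => { S : Subobject (K.X i) // P (S : C) }) i (m + 1)
      ⟨⊥, hbot _⟩ (fun k _ _ => ⟨⊥, hbot _⟩)
      (fun k hk T => ⟨G (k - 1) k (by lia) (hK _ (by lia)) T.1 T.2, hG _ _ _ _ _ _⟩)
  have hS : ∀ i, m < i → (S i).1 = ⊥ := by
    intro i hi
    obtain rfl | hi' := (show m + 1 ≤ i by lia).eq_or_lt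
    · simp only [S, Int.inductionOn'_self]
    · obtain ⟨i, rfl⟩ : ∃ i', i = i' + 1 := ⟨i - 1, by lia⟩
      simp only [S]
      rw [Int.inductionOn'_add_one (by lia)]
  have hS' : ∀ i j, i + 1 = j → i ≤ m → IsAdapted K (S i).1 (S j).1 := by
    rintro i j hij hi
    obtain rfl : i = j - 1 := by lia
    have : (S (j - 1)).1 = G (j - 1) j (by lia) (hK _ hi) (S j).1 (S j).2 := by
      simp only [S]
      rw [Int.inductionOn'_sub_one (by lia)]
    rw [this]
    exact hG' _ _ _ _ _ _
  have hd : ∀ i j, (S j).1.Factors ((S i).1.arrow ≫ K.d i j) := by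
    intro i j
    by_cases hij : i + 1 = j
    · by_cases hi : i ≤ m
      · exact (hS' i j hij hi).factors
      · have : (S i).1.arrow = 0 := by rw [hS i (by lia), Subobject.bot_arrow]
        rw [this, zero_comp]
        exact Subobject.factors_zero
    · rw [K.shape i j hij, comp_zero]
      exact Subobject.factors_zero
  let f := subcomplexι K (fun i => (S i).1) hd
  have hf : ∀ i ⦃B : C⦄ (x : B ⟶ K.X i), (S i).1.Factors x ↔ ∃ y, y ≫ f.f i = x :=
    fun i B x => factors_iff_subcomplexι K _ hd i x
  have hf' : ∀ i, Mono (f.f i) := fun i => inferInstanceAs (Mono ((subcomplexι K _ hd).f i))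
  refine ⟨subcomplex K (fun i => (S i).1) hd, f, fun i => (S i).2, ?_, ?_⟩
  · intro i hi
    change IsZero ((S i).1 : C)
    rw [hS i hi]
    exact (isZero_zero C).of_iso Subobject.botCoeIsoZero
  · clear_value f
    intro i hi
    have hprev : (ComplexShape.up ℤ).prev i = i - 1 := by simp
    have hnext : (ComplexShape.up ℤ).next i = i + 1 := by simp
    rw [quasiIsoAt_iff_isIso_homologyMap]
    -- Injectivity in degree `i` uses `boundary` one degree lower; surjectivity uses `cocycle` in
    -- degree `i`.
    have : Mono (HomologicalComplex.homologyMap f i) := by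
      rw [HomologicalComplex.mono_homologyMap_iff_up_to_refinements _ (i - 1) i (i + 1)
        hprev hnext]
      intro B x hx y hy
      obtain ⟨B', π, hπ, x', hx', h⟩ := (hS' (i - 1) i (by lia) (by lia)).boundary y
        ((hf i _).2 ⟨x, hy⟩)
      obtain ⟨x', rfl⟩ := (hf _ _).1 hx'
      refine ⟨B', π, hπ, x', ?_⟩
      rw [← cancel_mono (f.f i)]
      simp [hy, h]
    have : Epi (HomologicalComplex.homologyMap f i) := by
      rw [HomologicalComplex.epi_homologyMap_iff_up_to_refinements _ (i - 1) i (i + 1)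
        hprev hnext]
      intro B y hy
      obtain ⟨B', π, hπ, x, z, hx, hx', h⟩ := (hS' i (i + 1) rfl hi).cocycle y hy
      obtain ⟨x, rfl⟩ := (hf _ _).1 hx
      refine ⟨B', π, hπ, x, ?_, z, h⟩
      rw [← cancel_mono (f.f (i + 1))]
      simpa using hx'
    exact isIso_of_mono_of_epi _

end Subcomplex

/-! ### Vanishing of morphisms in the derived category -/

section DerivedVanishing

variable {C : Type u} [Category.{v} C] [Abelian C] [HasDerivedCategory.{w} C]

open DerivedCategory

lemma Q_map_eq_zero_iff {K L : CochainComplex C ℤ} (f : K ⟶ L) :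
    Q.map f = 0 ↔ ∃ (K' : CochainComplex C ℤ) (s : K' ⟶ K),
      QuasiIso s ∧ Nonempty (Homotopy (s ≫ f) 0) := by
  constructor
  · intro hf
    have hf' : Qh.map ((HomotopyCategory.quotient _ _).map f) = Qh.map 0 := by
      have := quotientCompQhIso_hom_naturality f
      rw [hf, comp_zero] at this
      rw [Functor.map_zero]
      rwa [← cancel_mono ((quotientCompQhIso C).hom.app L), zero_comp]
    rw [MorphismProperty.map_eq_iff_precomp Qh
      (HomotopyCategory.quasiIso C (ComplexShape.up ℤ))] at hf'
    obtain ⟨K', s, hs, h⟩ := hf'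
    obtain ⟨K', rfl⟩ := HomotopyCategory.quotient_obj_surjective K'
    obtain ⟨s, rfl⟩ := (HomotopyCategory.quotient _ _).map_surjective s
    rw [HomotopyCategory.quotient_map_mem_quasiIso_iff, HomologicalComplex.mem_quasiIso_iff] at hs
    refine ⟨K', s, hs, ?_⟩
    rw [← HomotopyCategory.quotient_map_eq_zero_iff, Functor.map_comp, h, comp_zero]
  · rintro ⟨K', s, hs, ⟨h⟩⟩
    rw [← cancel_epi (Q.map s), ← Functor.map_comp, Q_map_eq_of_homotopy C h, comp_zero,
      Functor.map_zero]

/-- After a shift by `a`, such a morphism is a class in `Ext^(a - b)(X, Y)`, and `a - b ≥ n`. -/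
lemma singleFunctor_hom_eq_zero {X Y : C} (n : ℕ) [HasProjectiveDimensionLT X n] {a b : ℤ}
    (hab : b + n ≤ a) (f : (singleFunctor C a).obj X ⟶ (singleFunctor C b).obj Y) : f = 0 := by
  let := HasExt.standard C
  obtain ⟨i, hi⟩ : ∃ i : ℕ, (i : ℤ) = a - b := ⟨(a - b).toNat, by lia⟩
  have hn : n ≤ i := by lia
  have := HasProjectiveDimensionLT.subsingleton X n i hn Y
  have : Subsingleton (ShiftedHom ((singleFunctor C 0).obj X) ((singleFunctor C 0).obj Y) (i : ℤ)) :=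
    Abelian.Ext.homEquiv.symm.subsingleton
  let e₁ : ((singleFunctor C a).obj X)⟦a⟧ ≅ (singleFunctor C 0).obj X :=
    ((singleFunctors C).shiftIso a 0 a (by simp)).app X
  let e₂ : ((singleFunctor C b).obj Y)⟦a⟧ ≅ (singleFunctor C (b - a)).obj Y :=
    ((singleFunctors C).shiftIso a (b - a) b (by simp)).app Y
  let e₃ : ((singleFunctor C 0).obj Y)⟦(i : ℤ)⟧ ≅ (singleFunctor C (b - a)).obj Y :=
    ((singleFunctors C).shiftIso (i : ℤ) (b - a) 0 (by lia)).app Y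
  have h0 : e₁.inv ≫ f⟦a⟧' ≫ e₂.hom ≫ e₃.inv = 0 := Subsingleton.elim
    (α := ShiftedHom ((singleFunctor C 0).obj X) ((singleFunctor C 0).obj Y) (i : ℤ)) _ _
  apply (shiftFunctor (DerivedCategory C) a).map_injective
  rw [← cancel_mono (e₂.hom ≫ e₃.inv), ← cancel_epi e₁.inv, h0]
  simp

lemma Q_map_to_single_eq_zero (n : ℕ) (hn : ∀ X : C, HasProjectiveDimensionLT X n)
    (K : CochainComplex C ℤ) (a b : ℤ) (hab : b + n ≤ a) (hK : ∀ i, i ≠ a → K.ExactAt i)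
    (Y : C) (f : K ⟶ (HomologicalComplex.single C (.up ℤ) b).obj Y) : Q.map f = 0 := by
  have : K.IsGE a := (K.isGE_iff a).2 fun i hi => hK i hi.ne
  have : K.IsLE a := (K.isLE_iff a).2 fun i hi => hK i hi.ne'
  obtain ⟨X, ⟨e⟩⟩ := exists_iso_singleFunctor_obj_of_isGE_of_isLE (Q.obj K) a
  have := hn X
  have h : (e.inv ≫ Q.map f : (singleFunctor C a).obj X ⟶ (singleFunctor C b).obj Y) = 0 :=
    singleFunctor_hom_eq_zero n hab _
  rw [← cancel_epi e.inv, comp_zero]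
  exact h

end DerivedVanishing

/-! ### Bounded approximation from finite global dimension -/

section BoundedApproximation

variable {C : Type u} [Category.{v} C] [Abelian C]

/-- A morphism of cochain complexes may be replaced by zero below degree `j`, provided
its component in degree `j` is modified suitably. -/
lemma exists_hom_eq_zero_below {K L : CochainComplex C ℤ} (s : K ⟶ L) (j : ℤ)
    (u : K.X j ⟶ L.X j) (h₁ : K.d (j - 1) j ≫ u = 0)
    (h₂ : u ≫ L.d j (j + 1) = K.d j (j + 1) ≫ s.f (j + 1)) :
    ∃ s' : K ⟶ L, (∀ i < j, s'.f i = 0) ∧ ∀ i, j < i → s'.f i = s.f i := by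
  let φ : ∀ i, K.X i ⟶ L.X i := fun i =>
    if i < j then 0 else if h : i = j then eqToHom (by rw [h]) ≫ u ≫ eqToHom (by rw [h])
      else s.f i
  have hφ₁ : ∀ i < j, φ i = 0 := fun i hi => if_pos hi
  have hφ₂ : φ j = u := by simp [φ]
  have hφ₃ : ∀ i, j < i → φ i = s.f i := fun i hi => by
    simp [φ, hi.not_gt, hi.ne']
  refine ⟨{ f := φ, comm' := ?_ }, hφ₁, hφ₃⟩
  rintro i i' (rfl : i + 1 = i')
  obtain hi | rfl | hi := lt_trichotomy i j
  · rw [hφ₁ i hi, zero_comp]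
    obtain hi' | rfl := (show i + 1 ≤ j by lia).lt_or_eq
    · rw [hφ₁ _ hi', comp_zero]
    · rw [hφ₂]
      rw [add_sub_cancel_right] at h₁
      exact h₁.symm
  · rw [hφ₂, hφ₃ _ (by lia), h₂]
  · rw [hφ₃ _ hi, hφ₃ _ (by lia), s.comm]

lemma homologyMap_eq_of_f_eq {K L : CochainComplex C ℤ} {f g : K ⟶ L} {i : ℤ}
    (h : f.f i = g.f i) :
    HomologicalComplex.homologyMap f i = HomologicalComplex.homologyMap g i := by
  have : HomologicalComplex.cyclesMap f i = HomologicalComplex.cyclesMap g i := by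
    rw [← cancel_mono (L.iCycles i)]
    simp [h]
  rw [← cancel_epi (K.homologyπ i)]
  simp [this]

variable {P : ObjectProperty C} [P.IsSerreClass] [HasDerivedCategory.{w} C]

/-- A subcomplex `S` concentrates the cohomology in degree `m`. The map from `S` to the boundaries
in degree `j`, placed in degree `j - 1`, is then a higher Ext class, hence zero. So it becomes
null-homotopic on some `R` quasi-isomorphic to `S`, and the homotopy deforms `R ⟶ S` to a map
vanishing below `j`. Such a map factors through a truncation. -/
lemma exists_bounded_approximation (hP : HasLiftsAlongEpis P) (n : ℕ)
    (hn : ∀ X : C, HasProjectiveDimensionLT X n) (K : CochainComplex C ℤ) (m : ℤ)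
    (hK : ∀ i < m, K.ExactAt i) (hm : P (K.homology m)) :
    ∃ (L : CochainComplex C ℤ) (g : L ⟶ K), (∀ i, P (L.X i)) ∧ (∀ i, m < i → IsZero (L.X i)) ∧
      (∀ i, i < m - n - 1 → IsZero (L.X i)) ∧ ∀ i ≤ m, QuasiIsoAt g i := by
  obtain ⟨S, f, hS, hS', hf⟩ := exists_subcomplex hP K m (fun i hi => by
    obtain rfl | hi := hi.eq_or_lt
    · exact hm
    · exact P.prop_of_isZero (hK i hi).isZero_homology)
  have hSm : ∀ i, i ≠ m → S.ExactAt i := fun i hi => by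
    obtain hi | hi := hi.lt_or_gt
    · have := hf i hi.le
      rw [exactAt_iff_of_quasiIsoAt f i]
      exact hK i hi
    · exact ShortComplex.exact_of_isZero_X₂ _ (hS' i hi)
  -- The obstruction has Ext degree `m - (j - 1) = n + 2`, and `j < m` keeps degree `m` unaffected
  -- by the modification.
  obtain ⟨j, hj⟩ : ∃ j, j = m - n - 1 := ⟨_, rfl⟩
  -- the obstruction to replacing `S` by its brutal truncation in degrees `≥ j`
  let p : S ⟶ (HomologicalComplex.single C (.up ℤ) (j - 1)).obj (image (S.d (j - 1) j)) :=
    HomologicalComplex.mkHomToSingle (factorThruImage (S.d (j - 1) j)) (fun i hi => by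
      rw [← cancel_mono (image.ι _)]
      simp)
  obtain ⟨R, s, hs, ⟨H⟩⟩ := (Q_map_eq_zero_iff p).1
    (Q_map_to_single_eq_zero n hn S m (j - 1) (by lia) hSm _ p)
  obtain ⟨h, hh⟩ : ∃ h : R.X j ⟶ image (S.d (j - 1) j),
      R.d (j - 1) j ≫ h = s.f (j - 1) ≫ factorThruImage (S.d (j - 1) j) := by
    refine ⟨H.hom j (j - 1) ≫ (HomologicalComplex.singleObjXSelf (.up ℤ) (j - 1) _).hom, ?_⟩
    have := H.comm (j - 1)
    rw [prevD_eq _ (show (ComplexShape.up ℤ).Rel (j - 2) (j - 1) by simp; lia),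
      dNext_eq _ (show (ComplexShape.up ℤ).Rel (j - 1) j by simp)] at this
    rw [HomologicalComplex.single_obj_d, comp_zero, add_zero, HomologicalComplex.zero_f, add_zero,
      HomologicalComplex.comp_f, HomologicalComplex.mkHomToSingle_f] at this
    rw [← Category.assoc, ← this]
    simp
  -- Subtracting `h` makes the degree `j` component kill the boundaries of `R`, so zero is allowed
  -- below `j`.
  obtain ⟨s', hs'₁, hs'₂⟩ := exists_hom_eq_zero_below s j
    (s.f j - h ≫ image.ι (S.d (j - 1) j)) (by
      rw [Preadditive.comp_sub, reassoc_of% hh, image.fac, s.comm, sub_self]) (by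
      have : image.ι (S.d (j - 1) j) ≫ S.d j (j + 1) = 0 := by
        rw [← cancel_epi (factorThruImage (S.d (j - 1) j))]
        simp
      rw [Preadditive.sub_comp, Category.assoc, this, comp_zero, sub_zero, s.comm])
  have hRm : ∀ i, i ≠ m → R.ExactAt i := fun i hi => by
    rw [exactAt_iff_of_quasiIsoAt s i]
    exact hSm i hi
  -- The terms of `R` need not lie in `P`, so a second subcomplex is taken.
  obtain ⟨T, t, hT, hT', ht⟩ := exists_subcomplex hP R m (fun i hi => by
    obtain rfl | hi := hi.eq_or_lt
    · have := hf i le_rfl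
      exact P.prop_of_iso (asIso (HomologicalComplex.homologyMap (s ≫ f) i)).symm hm
    · exact P.prop_of_isZero (hRm i hi.ne).isZero_homology)
  have hTm : ∀ i < m, T.ExactAt i := fun i hi => by
    have := ht i hi.le
    rw [exactAt_iff_of_quasiIsoAt t i]
    exact hRm i hi.ne
  obtain ⟨I, e, r, _, _, her⟩ : ∃ (I : CochainComplex C ℤ) (e : T ⟶ I) (r : I ⟶ S),
      Epi e ∧ Mono r ∧ e ≫ r = t ≫ s' :=
    ⟨_, factorThruImage _, image.ι _, inferInstance, inferInstance, image.fac _⟩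
  have hI : I.IsStrictlyGE j := (I.isStrictlyGE_iff j).2 fun i hi => by
    rw [IsZero.iff_id_eq_zero, ← cancel_mono (r.f i), ← cancel_epi (e.f i)]
    have := congrArg (fun k => k.f i) her
    simpa [hs'₁ i hi] using this
  have hTj : T.IsGE j := (T.isGE_iff j).2 fun i hi => hTm i (by lia)
  -- The image `I` vanishes below `j`, so it agrees with its own truncation, and `T ⟶ I` factors
  -- through that of `T`.
  let q : T.truncGE j ⟶ S :=
    CochainComplex.truncGEMap e j ≫ inv (I.πTruncGE j) ≫ r
  have hq : T.πTruncGE j ≫ q = t ≫ s' := by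
    simp only [q, CochainComplex.πTruncGE_naturality_assoc, IsIso.hom_inv_id_assoc, her]
  have hepi : ∀ i, Epi ((T.πTruncGE j).f i) := fun i => by
    dsimp [CochainComplex.πTruncGE]
    infer_instance
  refine ⟨T.truncGE j, q ≫ f, fun i => P.prop_of_epi ((T.πTruncGE j).f i) (hT i),
    fun i hi => ?_, fun i hi => ?_, fun i hi => ?_⟩
  · exact IsZero.of_epi ((T.πTruncGE j).f i) (hT' i hi)
  · exact (T.truncGE j).isZero_of_isStrictlyGE j i (by lia)
  · have := hf i hi
    suffices QuasiIsoAt q i from inferInstance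
    suffices QuasiIsoAt (t ≫ s') i by
      rw [← hq] at this
      exact quasiIsoAt_of_comp_left (T.πTruncGE j) q i
    -- In degree `m` the maps `s'` and `s` coincide; below `m` both complexes are exact.
    obtain rfl | hi := hi.eq_or_lt
    · have := ht i le_rfl
      rw [quasiIsoAt_iff_isIso_homologyMap, homologyMap_eq_of_f_eq (g := t ≫ s) (by
        simp [hs'₂ i (by lia)])]
      infer_instance
    · rw [quasiIsoAt_iff_exactAt _ _ (hTm i hi)]
      exact hSm i hi.ne

end BoundedApproximation

/-! ### The tower of approximations and its colimit -/

section Tower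

variable {C : Type u} [Category.{v} C] [Abelian C]

open HomologicalComplex ComposableArrows

/-- The five lemma for the long exact cohomology sequences. -/
lemma isIso_homologyMap_τ₂ {S₁ S₂ : ShortComplex (CochainComplex C ℤ)} (φ : S₁ ⟶ S₂)
    (hS₁ : S₁.ShortExact) (hS₂ : S₂.ShortExact) (i : ℤ)
    (h₃ : Epi (homologyMap φ.τ₃ (i - 1))) (h₁ : IsIso (homologyMap φ.τ₁ i))
    (h₃' : IsIso (homologyMap φ.τ₃ i)) (h₁' : Mono (homologyMap φ.τ₁ (i + 1))) :
    IsIso (homologyMap φ.τ₂ i) := by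
  have hi : (ComplexShape.up ℤ).Rel (i - 1) i := by simp
  have hi' : (ComplexShape.up ℤ).Rel i (i + 1) := by simp
  let R := fun {S : ShortComplex (CochainComplex C ℤ)} (hS : S.ShortExact) =>
    mk₄ (hS.δ (i - 1) i hi) (homologyMap S.f i) (homologyMap S.g i) (hS.δ i (i + 1) hi')
  have hR : ∀ {S : ShortComplex (CochainComplex C ℤ)} (hS : S.ShortExact), (R hS).Exact :=
    fun hS => exact_of_δ₀ (hS.homology_exact₁ _ _ hi).exact_toComposableArrows
      (exact_of_δ₀ (hS.homology_exact₂ i).exact_toComposableArrows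
        (hS.homology_exact₃ _ _ hi').exact_toComposableArrows)
  let ψ : R hS₁ ⟶ R hS₂ := homMk₄ (homologyMap φ.τ₃ _) (homologyMap φ.τ₁ _) (homologyMap φ.τ₂ _)
    (homologyMap φ.τ₃ _) (homologyMap φ.τ₁ _)
    (HomologySequence.δ_naturality φ hS₁ hS₂ _ _ hi)
    (by
      change homologyMap S₁.f i ≫ homologyMap φ.τ₂ i = homologyMap φ.τ₁ i ≫ homologyMap S₂.f i
      rw [← homologyMap_comp, ← homologyMap_comp, φ.comm₁₂])
    (by
      change homologyMap S₁.g i ≫ homologyMap φ.τ₃ i = homologyMap φ.τ₂ i ≫ homologyMap S₂.g i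
      rw [← homologyMap_comp, ← homologyMap_comp, φ.comm₂₃])
    (HomologySequence.δ_naturality φ hS₁ hS₂ _ _ hi')
  exact Abelian.isIso_of_epi_of_isIso_of_isIso_of_mono (hR hS₁) (hR hS₂) ψ h₃ h₁ h₃' h₁'

/-- The pullback of a short exact sequence along a morphism to its third object. -/
lemma exists_shortExact_pullback {S : ShortComplex C} (h : S.ShortExact) {L : C}
    (g : L ⟶ S.X₃) :
    ∃ (E : C) (a : S.X₁ ⟶ E) (q : E ⟶ L) (w : a ≫ q = 0) (r : E ⟶ S.X₂),
      a ≫ r = S.f ∧ r ≫ S.g = q ≫ g ∧ (ShortComplex.mk a q w).ShortExact := by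
  have := h.mono_f
  have := h.epi_g
  let a : S.X₁ ⟶ pullback S.g g := pullback.lift S.f 0 (by simp)
  have ha : a ≫ pullback.fst S.g g = S.f := pullback.lift_fst _ _ _
  have ha' : a ≫ pullback.snd S.g g = 0 := pullback.lift_snd _ _ _
  have : Mono a := by
    have : Mono (a ≫ pullback.fst S.g g) := by rwa [ha]
    exact mono_of_mono _ (pullback.fst S.g g)
  refine ⟨_, a, pullback.snd S.g g, ha', pullback.fst S.g g, ha, pullback.condition,
    { exact := ShortComplex.exact_of_f_is_kernel _ (KernelFork.IsLimit.ofι' _ _ ?_) }⟩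
  intro W k hk
  refine ⟨h.exact.lift (k ≫ pullback.fst S.g g) ?_, ?_⟩
  · rw [Category.assoc, pullback.condition, reassoc_of% hk, zero_comp]
  · apply pullback.hom_ext
    · rw [Category.assoc, ha, h.exact.lift_f]
    · rw [Category.assoc, ha', comp_zero, hk]

/-- The projection `M ⊞ Z ⟶ Z` is a homotopy equivalence when `M` is the cone of an identity. -/
lemma quasiIso_biprod_snd (K Z : CochainComplex C ℤ) :
    QuasiIso (biprod.snd : CochainComplex.mappingCone (𝟙 K) ⊞ Z ⟶ Z) := by
  let e : HomotopyEquiv (CochainComplex.mappingCone (𝟙 K) ⊞ Z) Z :=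
    { hom := biprod.snd
      inv := biprod.inr
      homotopyHomInvId :=
        let h₀ : Homotopy (𝟙 (CochainComplex.mappingCone (𝟙 K))) 0 :=
          CochainComplex.mappingCone.liftHomotopy _ _ _ (CochainComplex.mappingCone.snd _) 0
            (by simp) (by simp)
        let h₁ := (h₀.compRight
          (biprod.inl : _ ⟶ CochainComplex.mappingCone (𝟙 K) ⊞ Z)).compLeft
            (biprod.fst : CochainComplex.mappingCone (𝟙 K) ⊞ Z ⟶ _)
        let h₂ := Homotopy.add h₁ (Homotopy.refl (biprod.snd ≫ biprod.inr))
        (Homotopy.ofEq (by simp)).trans (h₂.symm.trans (Homotopy.ofEq (by simp)))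
      homotopyInvHomId := Homotopy.ofEq (by simp) }
  exact e.quasiIso_hom

/-- Any morphism of cochain complexes factors as a monomorphism followed by a
quasi-isomorphism. -/
lemma exists_mono_comp_quasiIso {K Z : CochainComplex C ℤ} (f : K ⟶ Z) :
    ∃ (L : CochainComplex C ℤ) (a : K ⟶ L) (b : L ⟶ Z), Mono a ∧ QuasiIso b ∧ a ≫ b = f := by
  refine ⟨_, biprod.lift (CochainComplex.mappingCone.inr (𝟙 K)) f, biprod.snd, ?_,
    quasiIso_biprod_snd K Z, by simp⟩
  have : Mono (CochainComplex.mappingCone.inr (𝟙 K)) :=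
    mono_of_mono_f _ fun i => by
      have := CochainComplex.mappingCone.inr_f_snd_v (𝟙 K) i
      exact (SplitMono.mk _ this).mono
  have : Mono (biprod.lift (CochainComplex.mappingCone.inr (𝟙 K)) f ≫ biprod.fst) := by
    rwa [biprod.lift_fst]
  exact mono_of_mono _ biprod.fst

/-- An approximation of a cochain complex `Z` by a complex of objects of `P` concentrated in
degrees `≤ k` which is a quasi-isomorphism in these degrees. -/
structure Approximation (P : ObjectProperty C) (Z : CochainComplex C ℤ) (k : ℤ) where
  /-- the approximating complex -/
  K : CochainComplex C ℤ
  /-- the morphism to the given complex -/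
  f : K ⟶ Z
  prop : ∀ i, P (K.X i)
  isZero : ∀ i, k < i → IsZero (K.X i)
  quasiIsoAt : ∀ i ≤ k, QuasiIsoAt f i

/-- A sequential colimit of cochain complexes which is eventually constant in each degree. -/
lemma exists_isColimit_of_eventually_isIso (F : ℕ ⥤ CochainComplex C ℤ) (N : ℤ → ℕ)
    (hF : ∀ i n, N i ≤ n → IsIso ((F.map (homOfLE (Nat.le_add_right n 1))).f i)) :
    ∃ (c : Cocone F) (_ : IsColimit c), ∀ i n, N i ≤ n → IsIso ((c.ι.app n).f i) := by
  have h : ∀ i n, N i ≤ n →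
      (F ⋙ HomologicalComplex.eval C (.up ℤ) i).IsEventuallyConstantFrom n := by
    intro i n hn m φ
    obtain ⟨d, rfl⟩ := Nat.exists_eq_add_of_le (leOfHom φ)
    obtain rfl := Subsingleton.elim (homOfLE (Nat.le_add_right n d)) φ
    induction d with
    | zero =>
      have : homOfLE (Nat.le_add_right n 0) = 𝟙 n := Subsingleton.elim _ _
      rw [this]
      infer_instance
    | succ d hd =>
      have := hd
      have := hF i (n + d) (by lia)
      have h' : homOfLE (Nat.le_add_right n (d + 1)) = homOfLE (Nat.le_add_right n d) ≫
        homOfLE (Nat.le_add_right (n + d) 1) := Subsingleton.elim _ _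
      rw [h', Functor.map_comp]
      have : IsIso ((F ⋙ HomologicalComplex.eval C (.up ℤ) i).map
        (homOfLE (Nat.le_add_right (n + d) 1))) := this
      infer_instance
  have := fun i => (h i (N i) le_rfl).hasColimit
  refine ⟨colimit.cocone F, colimit.isColimit F, fun i n hn => ?_⟩
  exact (h i n hn).isIso_ι_of_isColimit
    (isColimitOfPreserves (HomologicalComplex.eval C (.up ℤ) i) (colimit.isColimit F))

lemma quasiIsoAt_of_isIso_f {K L : CochainComplex C ℤ} (f : K ⟶ L) (i : ℤ)
    (h₁ : IsIso (f.f (i - 1))) (h₂ : IsIso (f.f i)) (h₃ : IsIso (f.f (i + 1))) :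
    QuasiIsoAt f i := by
  rw [quasiIsoAt_iff' f (i - 1) i (i + 1) (by simp) (by simp)]
  let φ := (HomologicalComplex.shortComplexFunctor' C (.up ℤ) (i - 1) i (i + 1)).map f
  have : IsIso φ.τ₁ := h₁
  have : IsIso φ.τ₂ := h₂
  have : IsIso φ.τ₃ := h₃
  have := ShortComplex.isIso_of_isIso φ
  infer_instance

variable {P : ObjectProperty C} [P.IsSerreClass] [HasDerivedCategory.{w} C]

/-- Replace `Y.f` by a monomorphism `a`. Its cokernel has no cohomology in degrees `≤ k`, so it has
a bounded approximation `L`. Pulling the extension back along `L` gives a complex containing `Y.K`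
with quotient `L`; the two agree below degree `k - n`, where `L` vanishes. -/
lemma exists_next_approximation (hP : HasLiftsAlongEpis P) (n : ℕ)
    (hn : ∀ X : C, HasProjectiveDimensionLT X n) {Z : CochainComplex C ℤ} (k : ℤ)
    (hZ : P (Z.homology (k + 1))) (Y : Approximation P Z k) :
    ∃ (Y' : Approximation P Z (k + 1)) (t : Y.K ⟶ Y'.K), t ≫ Y'.f = Y.f ∧
      ∀ i < k - n, IsIso (t.f i) := by
  obtain ⟨E, a, b, _, _, hab⟩ := exists_mono_comp_quasiIso Y.f
  have ha : ∀ i ≤ k, QuasiIsoAt a i := fun i hi => by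
    have := Y.quasiIsoAt i hi
    rw [← hab] at this
    exact quasiIsoAt_of_comp_right a b i
  have hY : ∀ i, k < i → IsZero (Y.K.homology i) := fun i hi =>
    HomologicalComplex.ExactAt.isZero_homology (ShortComplex.exact_of_isZero_X₂ _ (Y.isZero i hi))
  let S := ShortComplex.mk a (cokernel.π a) (cokernel.condition a)
  have hS : S.ShortExact := { exact := ShortComplex.exact_cokernel a }
  obtain ⟨L, g, hL, hL₁, hL₂, hg⟩ := exists_bounded_approximation hP n hn (cokernel a) (k + 1)
    (fun i hi => by
      have := ha i (by lia)
      refine hS.exactAt_X₃ i inferInstance ?_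
      rintro _ rfl
      obtain hi | rfl := (show i ≤ k by lia).lt_or_eq
      · have := ha (i + 1) (by lia)
        infer_instance
      · exact ⟨fun _ _ _ => (hY _ (by lia)).eq_of_tgt _ _⟩) (by
      -- `Y.K` has no cohomology in degree `k + 2`, so the cohomology of the cokernel in degree `k +
      -- 1` is a quotient of that of `Z`.
      have : Epi (homologyMap (cokernel.π a) (k + 1)) :=
        (hS.homology_exact₃ (k + 1) (k + 1 + 1) (by simp)).epi_f
          ((hY _ (by lia)).eq_of_tgt _ _)
      exact P.prop_of_epi (homologyMap (cokernel.π a) (k + 1))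
        (P.prop_of_iso (asIso (homologyMap b (k + 1))).symm hZ))
  obtain ⟨Y', t, q, w, r, htr, hrq, hS'⟩ := exists_shortExact_pullback hS g
  let φ : ShortComplex.mk t q w ⟶ S :=
    { τ₁ := 𝟙 _, τ₂ := r, τ₃ := g, comm₁₂ := (Category.id_comp _).trans htr.symm, comm₂₃ := hrq }
  have hS'i := fun i => hS'.map_of_exact (HomologicalComplex.eval C (.up ℤ) i)
  refine ⟨{ K := Y'
            f := r ≫ b
            prop := fun i => P.prop_X₂_of_shortExact (hS'i i) (Y.prop i) (hL i)
            isZero := fun i hi => (hS'i i).exact.isZero_X₂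
              ((Y.isZero i (by lia)).eq_of_src _ _) ((hL₁ i hi).eq_of_tgt _ _)
            quasiIsoAt := fun i hi => ?_ }, t, ?_, fun i hi => ?_⟩
  · suffices QuasiIsoAt r i from inferInstance
    have h₁ := hg i hi
    have h₂ := hg (i - 1) (by lia)
    rw [quasiIsoAt_iff_isIso_homologyMap] at h₁ h₂ ⊢
    have h₃ : ∀ i, IsIso (homologyMap φ.τ₁ i) := fun i =>
      inferInstanceAs (IsIso (homologyMap (𝟙 Y.K) i))
    exact isIso_homologyMap_τ₂ φ hS' hS i (h₂.epi_of_iso _) (h₃ _) h₁ ((h₃ _).mono_of_iso _)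
  · rw [← Category.assoc, htr]
    exact hab
  · have := (hS'i i).mono_f
    have := (hS'i i).exact.epi_f ((hL₂ i (by lia)).eq_of_tgt _ _)
    exact isIso_of_mono_of_epi (C := C)
      ((ShortComplex.mk t q w).map (HomologicalComplex.eval C (.up ℤ) i)).f

/-- A cochain complex whose cohomology belongs to `P` is quasi-isomorphic to a complex of
objects of `P`, if the global dimension is finite and objects of `P` lift along epimorphisms. -/
theorem exists_quasiIso_from_complex (hP : HasLiftsAlongEpis P) (n : ℕ)
    (hn : ∀ X : C, HasProjectiveDimensionLT X n) (Z : CochainComplex C ℤ)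
    (hZ : ∀ i, P (Z.homology i)) :
    ∃ (K : CochainComplex C ℤ) (f : K ⟶ Z), QuasiIso f ∧ ∀ i, P (K.X i) := by
  obtain ⟨K₀, f₀, h₁, h₂, h₃⟩ := exists_subcomplex hP Z 0 fun i _ => hZ i
  choose next t ht ht' using fun k => exists_next_approximation hP n hn (Z := Z) k (hZ _)
  let Y : ∀ k : ℕ, Approximation P Z k := fun k =>
    Nat.rec ⟨K₀, f₀, h₁, h₂, h₃⟩ (fun k Y => next k Y) k
  let F : ℕ ⥤ CochainComplex C ℤ :=
    Functor.ofSequence (X := fun k => (Y k).K) (fun k => t k (Y k))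
  have hF : ∀ k : ℕ, F.map (homOfLE (Nat.le_add_right k 1)) = t k (Y k) := fun k =>
    Functor.ofSequence_map_homOfLE_succ _ k
  obtain ⟨c, hc, hcι⟩ := exists_isColimit_of_eventually_isIso F (fun i => (i + n + 1).toNat)
    (fun i k hk => by
      rw [hF]
      exact ht' _ _ _ (by lia))
  let s : Cocone F :=
    { pt := Z
      ι := NatTrans.ofSequence (fun k => (Y k).f) (fun k =>
        (congrArg (fun l => l ≫ (Y (k + 1)).f) (hF k)).trans
          ((ht k (Y k)).trans (Category.comp_id _).symm)) }
  refine ⟨c.pt, hc.desc s, ⟨fun i => ?_⟩, fun i => ?_⟩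
  -- Cohomology in degree `i` involves degrees `i - 1`, `i`, `i + 1`; the last is stable once `k ≥
  -- (i + 1) + n + 1`.
  · obtain ⟨k, hk⟩ : ∃ k : ℕ, i + n + 2 ≤ k ∧ i ≤ k :=
      ⟨(max (i + n + 2) i).toNat, by lia, by lia⟩
    have := quasiIsoAt_of_isIso_f (c.ι.app k) i (hcι _ _ (by lia)) (hcι _ _ (by lia))
      (hcι _ _ (by lia))
    have : QuasiIsoAt (c.ι.app k ≫ hc.desc s) i := by
      rw [hc.fac]
      exact (Y k).quasiIsoAt i hk.2
    exact quasiIsoAt_of_comp_left (c.ι.app k) _ i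
  · have := hcι i _ le_rfl
    exact P.prop_of_iso (asIso ((c.ι.app (i + n + 1).toNat).f i)) ((Y _).prop i)

end Tower

/-! ### From resolutions to the equivalence of derived categories -/

section Comparison

open DerivedCategory

variable {C : Type u} [Category.{v} C] [Abelian C] (P : ObjectProperty C)

lemma exists_mapHomologicalComplex_iso (K : CochainComplex C ℤ) (hK : ∀ i, P (K.X i)) :
    ∃ L : CochainComplex P.FullSubcategory ℤ,
      Nonempty ((P.ι.mapHomologicalComplex (.up ℤ)).obj L ≅ K) := by
  let L : CochainComplex P.FullSubcategory ℤ :=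
    { X := fun i => ⟨K.X i, hK i⟩
      d := fun i j => ObjectProperty.homMk (K.d i j)
      shape := fun i j hij => by
        ext
        exact K.shape i j hij
      d_comp_d' := fun i j k _ _ => by
        ext
        exact K.d_comp_d i j k }
  exact ⟨L, ⟨HomologicalComplex.Hom.isoOfComponents (fun i => Iso.refl _) (fun i j _ =>
    (Category.id_comp _).trans (Category.comp_id _).symm)⟩⟩

variable [P.IsSerreClass]

lemma prop_homology_mapHomologicalComplex (L : CochainComplex P.FullSubcategory ℤ) (i : ℤ) :
    P (((P.ι.mapHomologicalComplex (.up ℤ)).obj L).homology i) :=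
  P.prop_of_iso ((L.sc i).mapHomologyIso P.ι).symm (L.sc i).homology.property

/-- Every cochain complex in `C` whose cohomology belongs to `P` receives a
quasi-isomorphism from a complex of objects of `P`. -/
def HasResolutions : Prop :=
  ∀ (Z : CochainComplex C ℤ), (∀ i, P (Z.homology i)) →
    ∃ (L : CochainComplex P.FullSubcategory ℤ)
      (g : (P.ι.mapHomologicalComplex (.up ℤ)).obj L ⟶ Z), QuasiIso g

variable {P}

/-- Denominators in `C` over a complex from `P` can be refined to denominators in `P`; this turns
fractions in `D(C)` into fractions in `D(P)`. -/
lemma HasResolutions.exists_hom (hP : HasResolutions P) {Z : CochainComplex C ℤ}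
    {K : CochainComplex P.FullSubcategory ℤ}
    (s : Z ⟶ (P.ι.mapHomologicalComplex (.up ℤ)).obj K) [QuasiIso s] :
    ∃ (L : CochainComplex P.FullSubcategory ℤ)
      (g : (P.ι.mapHomologicalComplex (.up ℤ)).obj L ⟶ Z) (t : L ⟶ K), QuasiIso g ∧ QuasiIso t ∧
        g ≫ s = (P.ι.mapHomologicalComplex (.up ℤ)).map t := by
  obtain ⟨L, g, hg⟩ := hP Z fun i =>
    P.prop_of_iso (asIso (HomologicalComplex.homologyMap s i)).symm
      (prop_homology_mapHomologicalComplex P K i)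
  obtain ⟨t, ht⟩ := (P.ι.mapHomologicalComplex (.up ℤ)).map_surjective (g ≫ s)
  refine ⟨L, g, t, hg, ?_, ht.symm⟩
  rw [← HomologicalComplex.quasiIso_map_iff_of_preservesHomology t P.ι, ht]
  infer_instance

variable [HasDerivedCategory.{w} C]

lemma hasResolutions_of_hasLiftsAlongEpis (hP : HasLiftsAlongEpis P)
    (hC : HasFiniteGlobalDimension C) : HasResolutions P := by
  intro Z hZ
  obtain ⟨n, hn⟩ := hC
  obtain ⟨K, f, hf, hK⟩ := exists_quasiIso_from_complex hP n hn Z hZ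
  obtain ⟨L, ⟨e⟩⟩ := exists_mapHomologicalComplex_iso P K hK
  exact ⟨L, e.hom ≫ f, inferInstance⟩

variable [HasDerivedCategory.{w₁} P.FullSubcategory]

lemma mapDerivedCategory_map_Q_map {K L : CochainComplex P.FullSubcategory ℤ} (f : K ⟶ L) :
    P.ι.mapDerivedCategory.map (Q.map f) = P.ι.mapDerivedCategoryFactors.hom.app K ≫
      Q.map ((P.ι.mapHomologicalComplex (.up ℤ)).map f) ≫
        P.ι.mapDerivedCategoryFactors.inv.app L := by
  have := P.ι.mapDerivedCategoryFactors_hom_naturality f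
  rw [← reassoc_of% this]
  simp

lemma HasResolutions.Q_map_eq_zero (hP : HasResolutions P)
    {K L : CochainComplex P.FullSubcategory ℤ} (f : K ⟶ L)
    (hf : Q.map ((P.ι.mapHomologicalComplex (.up ℤ)).map f) = 0) : Q.map f = 0 := by
  obtain ⟨Z, s, hs, ⟨h⟩⟩ := (Q_map_eq_zero_iff _).1 hf
  obtain ⟨M, g, t, hg, ht, hgs⟩ := hP.exists_hom s
  refine (Q_map_eq_zero_iff _).2 ⟨M, t, ht, ?_⟩
  have h' : Nonempty (Homotopy ((P.ι.mapHomologicalComplex (.up ℤ)).map (t ≫ f)) 0) :=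
    ⟨(Homotopy.ofEq (by rw [Functor.map_comp, ← hgs, Category.assoc])).trans
      ((h.compLeft g).trans (Homotopy.ofEq (by simp)))⟩
  rw [← HomotopyCategory.quotient_map_eq_zero_iff] at h' ⊢
  -- The inclusion is fully faithful, so null-homotopies descend to `P`.
  apply (P.ι.mapHomotopyCategory (.up ℤ)).map_injective
  rw [Functor.map_zero]
  exact h'

lemma HasResolutions.faithful_mapDerivedCategory (hP : HasResolutions P) :
    P.ι.mapDerivedCategory.Faithful := by
  have key : ∀ {K L : CochainComplex P.FullSubcategory ℤ} (f : Q.obj K ⟶ Q.obj L),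
      P.ι.mapDerivedCategory.map f = 0 → f = 0 := by
    intro K L f hf
    obtain ⟨M, s, hs, g, rfl⟩ := right_fac f
    have h : P.ι.mapDerivedCategory.map (Q.map g) = 0 := by
      rw [Functor.map_comp] at hf
      rwa [← cancel_epi (P.ι.mapDerivedCategory.map (inv (Q.map s))), comp_zero]
    rw [mapDerivedCategory_map_Q_map] at h
    rw [hP.Q_map_eq_zero g (by simpa using h), comp_zero]
  refine ⟨fun {X Y} f g hfg => ?_⟩
  have := key ((Q.objObjPreimageIso X).hom ≫ (f - g) ≫ (Q.objObjPreimageIso Y).inv) (by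
    rw [Functor.map_comp, Functor.map_comp, Functor.map_sub, hfg, sub_self, zero_comp, comp_zero])
  rw [← sub_eq_zero, ← cancel_epi (Q.objObjPreimageIso X).hom,
    ← cancel_mono (Q.objObjPreimageIso Y).inv, Category.assoc, this, comp_zero, zero_comp]

lemma HasResolutions.full_mapDerivedCategory (hP : HasResolutions P) :
    P.ι.mapDerivedCategory.Full := by
  have key : ∀ {K L : CochainComplex P.FullSubcategory ℤ}
      (f : P.ι.mapDerivedCategory.obj (Q.obj K) ⟶ P.ι.mapDerivedCategory.obj (Q.obj L)),
      ∃ f', P.ι.mapDerivedCategory.map f' = f := by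
    intro K L f
    let α := P.ι.mapDerivedCategoryFactors
    obtain ⟨Z, s, hs, g, hf⟩ := right_fac (α.inv.app K ≫ f ≫ α.hom.app L)
    have hs' := (isIso_Q_map_iff_quasiIso C s).1 hs
    obtain ⟨M, r, t, hr, ht, hrs⟩ := hP.exists_hom s
    obtain ⟨u, hu⟩ := (P.ι.mapHomologicalComplex (.up ℤ)).map_surjective (r ≫ g)
    refine ⟨inv (Q.map t) ≫ Q.map u, ?_⟩
    have hf' : Q.map s ≫ α.inv.app K ≫ f ≫ α.hom.app L = Q.map g := by
      rw [hf, IsIso.hom_inv_id_assoc]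
    have hf'' : Q.map ((P.ι.mapHomologicalComplex (.up ℤ)).map t) ≫ α.inv.app K ≫ f =
        Q.map ((P.ι.mapHomologicalComplex (.up ℤ)).map u) ≫ α.inv.app L := by
      rw [← hrs, hu, Functor.map_comp, Functor.map_comp, ← hf']
      simp
    rw [Functor.map_comp, Functor.map_inv, IsIso.inv_comp_eq, mapDerivedCategory_map_Q_map,
      mapDerivedCategory_map_Q_map]
    simp only [Category.assoc]
    rw [← hf'']
  refine ⟨fun {X Y} f => ?_⟩
  obtain ⟨f', hf'⟩ := key (P.ι.mapDerivedCategory.map (Q.objObjPreimageIso X).hom ≫ f ≫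
    P.ι.mapDerivedCategory.map (Q.objObjPreimageIso Y).inv)
  refine ⟨(Q.objObjPreimageIso X).inv ≫ f' ≫ (Q.objObjPreimageIso Y).hom, ?_⟩
  rw [Functor.map_comp, Functor.map_comp, hf']
  simp [← Functor.map_comp, ← Functor.map_comp_assoc]

lemma HasResolutions.essSurj_derivedComparison (hP : HasResolutions P) :
    (derivedComparison P).EssSurj := by
  refine ⟨fun Y => ?_⟩
  let e := Q.objObjPreimageIso Y.obj
  obtain ⟨L, g, hg⟩ := hP (Q.objPreimage Y.obj) fun i =>
    P.prop_of_iso ((homologyFunctorFactors C i).app _)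
      (P.prop_of_iso ((homologyFunctor C i).mapIso e).symm (Y.property i))
  exact ⟨Q.obj L, ⟨ObjectProperty.isoMk _
    (P.ι.mapDerivedCategoryFactors.app L ≪≫ asIso (Q.map g) ≪≫ e)⟩⟩

/-- If every complex with cohomology in `P` has a resolution by objects of `P`, then the
comparison functor `D(P) ⥤ D_P(C)` is an equivalence. -/
theorem HasResolutions.isEquivalence_derivedComparison (hP : HasResolutions P) :
    (derivedComparison P).IsEquivalence where
  faithful := by
    have := hP.faithful_mapDerivedCategory
    exact inferInstanceAs ((cohomologyIn P).lift _ _).Faithful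
  full := by
    have := hP.full_mapDerivedCategory
    exact inferInstanceAs ((cohomologyIn P).lift _ _).Full
  essSurj := hP.essSurj_derivedComparison

end Comparison

end LocallyNoetherianDerived

open LocallyNoetherianDerived in
theorem corollary5p6 (A : Type u) [Category.{v} A] [Abelian A]
    [IsLocallyNoetherian.{w} A] (hA : HasFiniteGlobalDimension A)
    [HasDerivedCategory.{w₁} A]
    [HasDerivedCategory.{w₂} (isNoetherianObject (C := A)).FullSubcategory] :
    (derivedComparison (isNoetherianObject (C := A))).IsTriangulated ∧
      (derivedComparison (isNoetherianObject (C := A))).IsEquivalence := by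
  refine ⟨inferInstanceAs ((cohomologyIn isNoetherianObject).lift _ _).IsTriangulated, ?_⟩
  obtain ⟨S, -, hS, hS'⟩ := IsLocallyNoetherian.exists_noetherian_generators.{w} (C := A)
  exact (hasResolutions_of_hasLiftsAlongEpis
    (hasLiftsAlongEpis_isNoetherianObject hS hS') hA).isEquivalence_derivedComparison
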